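/- **Setting (online resource allocation).** Items $t=1,\dots,T$ arrive one at a time. There are a finite set $\mathcal J$ of supply nodes and a finite set $\mathcal K$ of $d$ resources with capacities $b_k\ge 0$. Item $t$ has parameters $\xi^t=(r^t,A^t)$, where $r^t_j\in\mathbb R$ is the reward of assigning it to supply node $j$ and $A^t_{jk}\ge 0$ is the amount of resource $k$ that this assignment consumes; the $\xi^t$ are i.i.d. with a law $\mathcal D$ under which every $r_j$ is integrable. Put $\Delta=\{x\in\{0,1\}^{\mathcal J}:\sum_j x_j\le 1\}$, and $$\mathrm{OPT}=\max\Big\{\sum_{t=1}^T r^t\cdot x^t\;:\;\sum_{t=1}^T (A^t)^\top x^t\le b,\ x^t\in\Delta\Big\}.$$ **Single-sample OSO.** In period $t$ the algorithm observes $\xi^t$, draws one fresh sample path $\tilde\xi^{t+1}_t,\dots,\tilde\xi^T_t$ of independent items with law $\mathcal D$, computes an optimal solution $(\tilde x^t,\dots,\tilde x^T)$ of $$\max\Big\{ r^t\cdot x^t+\sum_{\tau>t}\tilde r^\tau_t\cdot x^\tau\;:\; \sum_{\tau<t}(A^\tau)^\top\bar x^\tau+(A^t)^\top x^t+\sum_{\tau>t}(\tilde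 A^\tau_t)^\top x^\tau\le b,\ x^\tau\in\Delta\Big\},$$ and implements $\bar x^t=\tilde x^t$. Its value is $\mathrm{ALG}=\sum_{t} r^t\cdot\bar x^t$. The integer programs are solved exactly by a measurable solver, which takes as input the list of items and the vector of remaining capacities and may use a fresh independent random seed in each period. The solver is equivariant: for every number $n$ of items and every capacity vector, and for almost every list of $n$ items drawn from $\mathcal D^{\otimes n}$, permuting the items permutes (the law of) the returned solution in the same way. **Statement.** Fix the number $d$ of resources. For every $T\in\mathbb N$ let there be given such an instance with horizon $T$ (the number of supply nodes, the law $\mathcal D_T$, the capacities $b^{(T)}$ and the equivariant solver may all depend on $T$), and let $$B_T=\min_{k\in\mathcal K}\ \frac{b^{(T)}_k}{\max_{j} A_{jk}},$$ where the maximum is over all supply nodes $j$ and over the support of $\mathcal D_T$ (that is, an essential supremum); a resource with positive capacity that is almost surely never consumed contributes $+\infty$ to the minimum. If $B_T=\Omega(\log^{1+\sigma}T)$ as $T\to\infty$ for some constant $\sigma>0$, then single-sample OSO is asymptotically optimal: $\mathbb E[\mathrm{ALG}_T]\le\mathbb E[\mathrm{OPT}_T]$ for all $T$, and for every $\varepsilon>0$,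 $$\mathbb E[\mathrm{ALG}_T]\ \ge\ (1-\varepsilon)\,\mathbb E[\mathrm{OPT}_T]\qquad\text{for all sufficiently large }T.$$ In particular, if $\mathbb E[\mathrm{OPT}_T]>0$ for all large $T$, then $\mathbb E[\mathrm{ALG}_T]/\mathbb E[\mathrm{OPT}_T]\to 1$ as $T\to\infty$. -/

import Mathlib

open MeasureTheory Filter Topology
open scoped ENNReal

/-! Online resource allocation with supply nodes `J` and resources `K`. -/

namespace OnlineAlloc

/-- The parameters `ξ = (r, A)` of one item: `ξ.1 j` is the reward of assigning the item to supply
node `j`, and `ξ.2 j k` is the amount of resource `k` which that assignment consumes. -/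
abbrev Item (J K : Type) : Type := (J → ℝ) × (J → K → ℝ)

/-- An action for one item: it is assigned to at most one supply node. The action `some j` stands
for the binary vector with a single `1` at `j`, and `none` for the zero vector (rejection). -/
abbrev Action (J : Type) : Type := Option J

/-- The reward `r · x` of an action. -/
def reward {J K : Type} (ξ : Item J K) : Action J → ℝ
  | none => 0
  | some j => ξ.1 j

/-- The resource consumption `Aᵀ x` of an action. -/
def usage {J K : Type} (ξ : Item J K) : Action J → K → ℝ
  | none => 0
  | some j => ξ.2 j

/-- Feasibility of the plan `x` for the items `w` under the capacities `b`. -/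
def Feasible {J K : Type} {n : ℕ} (w : Fin n → Item J K) (b : K → ℝ)
    (x : Fin n → Action J) : Prop :=
  ∀ k, ∑ i, usage (w i) (x i) k ≤ b k

/-- The total reward of the plan `x` for the items `w`. -/
def totalReward {J K : Type} {n : ℕ} (w : Fin n → Item J K) (x : Fin n → Action J) : ℝ :=
  ∑ i, reward (w i) (x i)

/-- `x` is an optimal solution of the offline integer program with items `w`, capacities `b`. -/
def IsOptimal {J K : Type} {n : ℕ} (w : Fin n → Item J K) (b : K → ℝ)
    (x : Fin n → Action J) : Prop :=
  Feasible w b x ∧ ∀ y, Feasible w b y → totalReward w y ≤ totalReward w x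

/-- The offline (perfect-information) optimum. -/
noncomputable def OPT {J K : Type} {n : ℕ} (w : Fin n → Item J K) (b : K → ℝ) : ℝ :=
  ⨆ x : {x : Fin n → Action J // Feasible w b x}, totalReward w x.1

/-- The expected offline optimum over `T` items drawn independently from `D`. -/
noncomputable def expectedOPT {J K : Type} (D : Measure (Item J K)) (T : ℕ) (b : K → ℝ) : ℝ :=
  ∫ w, OPT w b ∂(Measure.pi fun _ : Fin T => D)

/-- An integer programming solver, which may use a random seed `θ : Θ` (to break ties between
optimal solutions, say): on every feasible program it returns an optimal solution. A deterministic
solver is one that ignores the seed. -/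
structure Solver (J K Θ : Type) [MeasurableSpace Θ] where
  solve : ∀ n : ℕ, (Fin n → Item J K) → (K → ℝ) → Θ → Fin n → Action J
  measurable_solve : ∀ (n : ℕ) (x : Fin n → Action J),
    MeasurableSet {p : (Fin n → Item J K) × (K → ℝ) × Θ | solve n p.1 p.2.1 p.2.2 = x}
  optimal : ∀ (n : ℕ) (w : Fin n → Item J K) (b : K → ℝ) (θ : Θ),
    (∃ x, Feasible w b x) → IsOptimal w b (solve n w b θ)

/-- The solver is equivariant: permuting the items permutes the solution in the same way. For a
solver with seed distribution `ρ` this is an equality of laws, because a program with repeated items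
need not have an optimal solution which treats equal items equally. It is only asked for on almost
every sequence of items drawn from `D`. -/
def Solver.IsEquivariant {J K Θ : Type} [MeasurableSpace Θ] (s : Solver J K Θ) (ρ : Measure Θ)
    (D : Measure (Item J K)) : Prop :=
  ∀ (n : ℕ) (b : K → ℝ), ∀ᵐ w ∂(Measure.pi fun _ : Fin n => D),
    ∀ (π : Equiv.Perm (Fin n)) (x : Fin n → Action J),
      ρ {θ | s.solve n (w ∘ π) b θ = x ∘ π} = ρ {θ | s.solve n w b θ = x}

/-- The randomness of a run of single-sample OSO over the periods `t : Fin T`. The entry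
`(ω t).1 t` is the item `ξᵗ` which arrives in period `t`; for `τ > t`, the entry `(ω t).1 τ` is the
item which the algorithm samples in period `t` for period `τ` (the entries with `τ < t` are not
used); and `(ω t).2` is the seed of the solver in period `t`. -/
abbrev Outcome (J K Θ : Type) (T : ℕ) : Type := Fin T → (Fin T → Item J K) × Θ

/-- All arriving items and all sampled items are independent with distribution `D`; all seeds are
independent of them and of each other, with distribution `ρ`. -/
noncomputable def outcomeLaw {J K Θ : Type} [MeasurableSpace Θ] (D : Measure (Item J K))
    (ρ : Measure Θ) (T : ℕ) : Measure (Outcome J K Θ T) :=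
  Measure.pi fun _ : Fin T => (Measure.pi fun _ : Fin T => D).prod ρ

/-- The item arriving in period `t`. -/
def Outcome.arrival {J K Θ : Type} {T : ℕ} (ω : Outcome J K Θ T) (t : Fin T) : Item J K :=
  (ω t).1 t

/-- The items of the program solved in period `t`: the arriving item `ξᵗ` comes first, followed by
the sampled items for the remaining periods. -/
def Outcome.window {J K Θ : Type} {T : ℕ} (ω : Outcome J K Θ T) (t : Fin T) :
    Fin (T - t.1) → Item J K :=
  fun i => (ω t).1 ⟨t.1 + i.1, by omega⟩

/-- The decision of OSO in period `t`, when `S` is the amount of resources consumed in the previous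
periods: solve the program with the arriving item, the sampled items and the remaining capacities,
and keep the part of the solution which concerns the arriving item. -/
def osoDecision {J K Θ : Type} [MeasurableSpace Θ] {T : ℕ} (s : Solver J K Θ) (b : K → ℝ)
    (ω : Outcome J K Θ T) (S : K → ℝ) (t : Fin T) : Action J :=
  s.solve (T - t.1) (ω.window t) (b - S) (ω t).2 ⟨0, by omega⟩

/-- The amount of resources consumed by OSO in the first `t` periods. -/
noncomputable def osoOccupancy {J K Θ : Type} [MeasurableSpace Θ] {T : ℕ} (s : Solver J K Θ)
    (b : K → ℝ) (ω : Outcome J K Θ T) : ℕ → K → ℝ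
  | 0 => 0
  | t + 1 => osoOccupancy s b ω t +
      if h : t < T then
        usage (ω.arrival ⟨t, h⟩) (osoDecision s b ω (osoOccupancy s b ω t) ⟨t, h⟩)
      else 0

/-- The total reward collected by OSO. -/
noncomputable def osoReward {J K Θ : Type} [MeasurableSpace Θ] {T : ℕ} (s : Solver J K Θ)
    (b : K → ℝ) (ω : Outcome J K Θ T) : ℝ :=
  ∑ t : Fin T, reward (ω.arrival t) (osoDecision s b ω (osoOccupancy s b ω t.1) t)

/-- The expected total reward of single-sample OSO. -/
noncomputable def expectedOSO {J K Θ : Type} [MeasurableSpace Θ] (s : Solver J K Θ)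
    (ρ : Measure Θ) (D : Measure (Item J K)) (T : ℕ) (b : K → ℝ) : ℝ :=
  ∫ ω, osoReward s b ω ∂(outcomeLaw D ρ T)

/-- `B = min_k b_k / max_j A_{jk}`, where the maximum also runs over the support of `D` (so the
items of all periods are covered). A resource with `b_k > 0` that is never consumed contributes
`∞`. -/
noncomputable def normalizedCapacity {J K : Type} (D : Measure (Item J K)) (b : K → ℝ) : ℝ≥0∞ :=
  ⨅ k, ENNReal.ofReal (b k) / ⨆ j, essSup (fun ξ : Item J K => ENNReal.ofReal (ξ.2 j k)) D

end OnlineAlloc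

/-! ### Offline programs, measurability, and resampling of product measures -/

namespace OnlineAlloc

variable {J K Θ : Type} {n : ℕ}

/-! Write V(n, c) for the expected offline optimum with n items and capacities c. In period t the
arriving item and the samples are n = T - t i.i.d. items, independent of the remaining capacities c.
By equivariance all n items contribute equally, so the conditional expected reward of the period is
V(n, c) / n, and the expected consumption of resource k is at most c_k / n
(`Solver.IsEquivariant.integral_reward`, `Solver.IsEquivariant.integral_usage_le`).

The second fact makes remaining capacity per remaining period, c_k / n, a submartingale. The square
of the positive part of b_k / T - c_k / n therefore grows in mean only through the variance of
single steps, which is small because one step uses at most b_k / β. Hence, until the last δT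
periods, the capacities are rarely much below their fair share (`integral_shortage_le`).

It remains to bound V(n, c) below when c is near its fair share. A stationary policy does this:
treat each item as the first item of an independent full-horizon program with capacities b. One step
earns V(T, b) / T on average and uses at most b_k / T on average. Run for slightly fewer than n
steps, the policy exhausts a resource with small probability, by a Chebyshev estimate carried
through an induction (`le_expectedOPT_of_policy`).

Together, each period before (1 - δ)T earns almost V(T, b) / T, and later periods have nonnegative
expected reward. The errors are of order d / β with constants depending on δ only, so it is enough
that B_T tends to infinity. -/

theorem le_OPT [Finite J] {w : Fin n → Item J K} {b : K → ℝ} {x : Fin n → Action J}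
    (hx : Feasible w b x) : totalReward w x ≤ OPT w b :=
  le_ciSup (f := fun x : {x : Fin n → Action J // Feasible w b x} => totalReward w x.1)
    (Set.finite_range _).bddAbove ⟨x, hx⟩

theorem IsOptimal.OPT_eq [Finite J] {w : Fin n → Item J K} {b : K → ℝ} {x : Fin n → Action J}
    (hx : IsOptimal w b x) : OPT w b = totalReward w x := by
  have : Nonempty {x : Fin n → Action J // Feasible w b x} := ⟨⟨x, hx.1⟩⟩
  exact le_antisymm (ciSup_le fun y => hx.2 y.1 y.2) (le_OPT hx.1)

theorem feasible_none {b : K → ℝ} (hb : ∀ k, 0 ≤ b k) (w : Fin n → Item J K) :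
    Feasible w b fun _ => none := by
  intro k
  simpa [usage] using hb k

theorem Solver.isOptimal [MeasurableSpace Θ] (s : Solver J K Θ) {b : K → ℝ} (hb : ∀ k, 0 ≤ b k)
    (w : Fin n → Item J K) (θ : Θ) : IsOptimal w b (s.solve n w b θ) :=
  s.optimal n w b θ ⟨_, feasible_none hb w⟩

theorem OPT_nonneg [Finite J] {b : K → ℝ} (hb : ∀ k, 0 ≤ b k) (w : Fin n → Item J K) :
    0 ≤ OPT w b := by
  simpa [totalReward, reward] using le_OPT (feasible_none hb w)

theorem expectedOPT_nonneg [Finite J] {b : K → ℝ} (hb : ∀ k, 0 ≤ b k) (D : Measure (Item J K)) :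
    0 ≤ expectedOPT D n b :=
  integral_nonneg fun w => OPT_nonneg hb w

theorem usage_nonneg {ξ : Item J K} (h : ∀ j k, 0 ≤ ξ.2 j k) (a : Action J) (k : K) :
    0 ≤ usage ξ a k := by
  cases a with
  | none => exact le_rfl
  | some j => exact h j k

theorem usage_le {M : K → ℝ} {ξ : Item J K} (hM0 : ∀ k, 0 ≤ M k) (h : ∀ j k, ξ.2 j k ≤ M k) (a : Action J)
    (k : K) : usage ξ a k ≤ M k := by
  cases a with
  | none => exact hM0 k
  | some j => exact h j k

theorem abs_reward_le [Fintype J] (ξ : Item J K) (a : Action J) :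
    |reward ξ a| ≤ ∑ j, |ξ.1 j| := by
  cases a with
  | none => simpa [reward] using Finset.sum_nonneg fun j _ => abs_nonneg (ξ.1 j)
  | some j =>
    exact Finset.single_le_sum (f := fun j => abs (ξ.1 j)) (fun j _ => abs_nonneg _)
      (Finset.mem_univ j)

theorem Feasible.usage_le {w : Fin n → Item J K} {b : K → ℝ} {x : Fin n → Action J}
    (hx : Feasible w b x) (hw : ∀ i j k, 0 ≤ (w i).2 j k) (i : Fin n) (k : K) :
    usage (w i) (x i) k ≤ b k :=
  (Finset.single_le_sum (f := fun i => usage (w i) (x i) k)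
    (fun i _ => usage_nonneg (hw i) _ _) (Finset.mem_univ i)).trans (hx k)

/-- An action for the first item followed by an optimal plan for the others. -/
theorem reward_add_OPT_le [Finite J] (ξ : Item J K) (w : Fin n → Item J K)
    {b : K → ℝ} (a : Action J) (ha : ∀ k, usage ξ a k ≤ b k) :
    reward ξ a + OPT w (b - usage ξ a) ≤
      OPT (Fin.cons ξ w : Fin (n + 1) → Item J K) b := by
  have hne : Nonempty {x : Fin n → Action J // Feasible w (b - usage ξ a) x} :=
    ⟨⟨_, feasible_none (fun k => sub_nonneg.2 (ha k)) w⟩⟩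
  obtain ⟨x, hx⟩ := exists_eq_ciSup_of_finite
    (f := fun x : {x : Fin n → Action J // Feasible w (b - usage ξ a) x} => totalReward w x.1)
  have hf : Feasible (Fin.cons ξ w : Fin (n + 1) → Item J K) b
      (Fin.cons a x.1 : Fin (n + 1) → Action J) := by
    intro k
    have := x.2 k
    simp only [Fin.sum_univ_succ, Fin.cons_zero, Fin.cons_succ, Pi.sub_apply] at this ⊢
    linarith
  have h := le_OPT hf
  rw [totalReward, Fin.sum_univ_succ] at h
  rw [OPT, ← hx]
  exact h

theorem measurable_reward (a : Action J) : Measurable fun ξ : Item J K => reward ξ a := by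
  cases a with
  | none => exact measurable_const
  | some j => exact (measurable_pi_apply j).comp measurable_fst

theorem measurable_usage (a : Action J) (k : K) :
    Measurable fun ξ : Item J K => usage ξ a k := by
  cases a with
  | none => exact measurable_const
  | some j =>
    exact (measurable_pi_apply k).comp ((measurable_pi_apply j).comp measurable_snd)

/-- There are finitely many plans, so the composite is a finite sum over plans of a measurable
function cut off to the event that this plan is returned. -/
theorem Solver.measurable_comp [Finite J] [MeasurableSpace Θ] (s : Solver J K Θ) {X : Type}
    [MeasurableSpace X] {w : X → Fin n → Item J K} {b : X → K → ℝ} {θ : X → Θ}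
    (hw : Measurable w) (hb : Measurable b) (hθ : Measurable θ)
    {f : Item J K → Action J → ℝ} (hf : ∀ a, Measurable fun ξ => f ξ a) (i : Fin n) :
    Measurable fun p => f (w p i) (s.solve n (w p) (b p) (θ p) i) := by
  classical
  have := Fintype.ofFinite J
  have key : (fun p => f (w p i) (s.solve n (w p) (b p) (θ p) i)) =
      fun p => ∑ x : Fin n → Action J,
        {p | s.solve n (w p) (b p) (θ p) = x}.indicator (fun p => f (w p i) (x i)) p := by
    funext p
    simp [Set.indicator_apply]
  rw [key]
  refine Finset.measurable_sum _ fun x _ => Measurable.indicator ?_ ?_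
  · exact (hf _).comp ((measurable_pi_apply i).comp hw)
  · exact (hw.prodMk (hb.prodMk hθ)) (s.measurable_solve n x)

/-- Selecting distinct coordinates of an i.i.d. family gives an i.i.d. family. -/
theorem measurePreserving_comp_injective {X : Type} [MeasurableSpace X] (D : Measure X)
    [IsProbabilityMeasure D] {m : ℕ} {e : Fin n → Fin m} (he : Function.Injective e) :
    MeasurePreserving (fun w : Fin m → X => w ∘ e) (Measure.pi fun _ => D)
      (Measure.pi fun _ => D) := by
  have h := (ProbabilityTheory.iIndepFun_pi (μ := fun _ : Fin m => D) (X := fun _ => id)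
    fun _ => aemeasurable_id).precomp he
  refine ⟨by fun_prop, ?_⟩
  have h2 := (ProbabilityTheory.iIndepFun_iff_map_fun_eq_pi_map
    fun i => (measurable_pi_apply (e i)).aemeasurable).1 h
  have h3 : ∀ i, (Measure.pi fun _ : Fin m => D).map (fun w => w (e i)) = D := fun i =>
    (measurePreserving_eval (fun _ : Fin m => D) (e i)).map_eq
  simp only [h3] at h2
  exact h2

/-- Resampling one coordinate of an independent family does not change its law. -/
theorem measurePreserving_update {ι : Type} [Fintype ι] [DecidableEq ι] {X : Type}
    [MeasurableSpace X] (μ : Measure X) [IsProbabilityMeasure μ] (i : ι) :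
    MeasurePreserving (fun p : (ι → X) × X => Function.update p.1 i p.2)
      ((Measure.pi fun _ => μ).prod μ) (Measure.pi fun _ => μ) := by
  have hm : Measurable fun p : (ι → X) × X => Function.update p.1 i p.2 := by
    refine measurable_pi_iff.2 fun j => ?_
    by_cases h : j = i
    · subst h; simpa using measurable_snd
    · simp only [Function.update_of_ne h]; fun_prop
  refine ⟨hm, (Measure.pi_eq fun s hs => ?_).symm⟩
  rw [Measure.map_apply hm (MeasurableSet.univ_pi hs)]
  -- The preimage of a box is again a box: the old coordinate `i` is unconstrained and the fresh one
  -- carries `s i`.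
  have : (fun p : (ι → X) × X => Function.update p.1 i p.2) ⁻¹' Set.univ.pi s =
      (Set.univ.pi (Function.update s i Set.univ)) ×ˢ s i := by
    ext p
    simp only [Set.mem_preimage, Set.mem_pi, Set.mem_univ, true_imp_iff, Set.mem_prod]
    constructor
    · intro h
      refine ⟨fun j => ?_, by simpa using h i⟩
      by_cases hj : j = i
      · subst hj; simp
      · simpa [Function.update_of_ne hj] using h j
    · rintro ⟨h, h'⟩ j
      by_cases hj : j = i
      · subst hj; simpa using h'
      · simpa [Function.update_of_ne hj] using h j
  rw [this, Measure.prod_prod, Measure.pi_pi, ← Finset.mul_prod_erase _ _ (Finset.mem_univ i),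
    ← Finset.mul_prod_erase _ (fun j => μ (s j)) (Finset.mem_univ i)]
  simp only [Function.update_self, measure_univ, one_mul]
  rw [mul_comm]
  congr 1
  refine Finset.prod_congr rfl fun j hj => ?_
  rw [Function.update_of_ne (Finset.ne_of_mem_erase hj)]

end OnlineAlloc
-- Exchangeability: equal shares of reward and consumption
namespace OnlineAlloc

variable {J K Θ : Type} {n : ℕ}

section Integrability
variable [Fintype J] {D : Measure (Item J K)} {X : Type} [MeasurableSpace X] {P : Measure X}

theorem integrable_reward (hr : ∀ j, Integrable (fun ξ : Item J K => ξ.1 j) D)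
    {ξ : X → Item J K} (hξ : MeasurePreserving ξ P D) {a : X → Action J}
    (hm : Measurable fun p => reward (ξ p) (a p)) :
    Integrable (fun p => reward (ξ p) (a p)) P := by
  have h : Integrable (fun ξ : Item J K => ∑ j, |ξ.1 j|) D :=
    integrable_finsetSum _ fun j _ => (hr j).abs
  refine ((hξ.integrable_comp h.aestronglyMeasurable).2 h).mono' hm.aestronglyMeasurable
    (ae_of_all _ fun p => ?_)
  exact abs_reward_le _ _

end Integrability

section Program
variable [MeasurableSpace Θ] {D : Measure (Item J K)} [IsProbabilityMeasure D]
  {ρ : Measure Θ} [IsProbabilityMeasure ρ]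

theorem measurePreserving_item (i : Fin n) :
    MeasurePreserving (fun p : (Fin n → Item J K) × Θ => p.1 i)
      ((Measure.pi fun _ => D).prod ρ) D :=
  (measurePreserving_eval (fun _ => D) i).comp measurePreserving_fst

theorem ae_items {p : Item J K → Prop} (hA : ∀ᵐ ξ ∂D, p ξ) :
    ∀ᵐ q : (Fin n → Item J K) × Θ ∂((Measure.pi fun _ => D).prod ρ), ∀ i, p (q.1 i) :=
  ae_all_iff.2 fun i => (measurePreserving_item i).quasiMeasurePreserving.ae hA

variable [Fintype J] {s : Solver J K Θ}

theorem Solver.measurable_program (s : Solver J K Θ) (c : K → ℝ) {f : Item J K → Action J → ℝ}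
    (hf : ∀ a, Measurable fun ξ => f ξ a) (i : Fin n) :
    Measurable fun p : (Fin n → Item J K) × Θ => f (p.1 i) (s.solve n p.1 c p.2 i) :=
  s.measurable_comp (b := fun _ => c) measurable_fst measurable_const measurable_snd hf i

theorem integrable_usage (hA : ∀ᵐ ξ ∂D, ∀ j k, 0 ≤ ξ.2 j k) {c : K → ℝ} (hc : ∀ k, 0 ≤ c k)
    (k : K) (i : Fin n) :
    Integrable (fun p : (Fin n → Item J K) × Θ => usage (p.1 i) (s.solve n p.1 c p.2 i) k)
      ((Measure.pi fun _ => D).prod ρ) := by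
  refine Integrable.of_bound
    (s.measurable_program c (fun a => measurable_usage a k) i).aestronglyMeasurable (c k) ?_
  filter_upwards [ae_items hA] with p hp
  rw [Real.norm_eq_abs, abs_of_nonneg (usage_nonneg (hp i) _ _)]
  exact (s.isOptimal hc p.1 p.2).1.usage_le hp i k

/-- Swapping positions `i` and `j` preserves the law of the items and, by equivariance, carries the
law of the plan along. Equivariance concerns laws only, so the seed is integrated out first. -/
theorem Solver.IsEquivariant.integral_eq (hs : s.IsEquivariant ρ D) (c : K → ℝ)
    {f : Item J K → Action J → ℝ}
    (hint : ∀ i, Integrable (fun p : (Fin n → Item J K) × Θ =>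
      f (p.1 i) (s.solve n p.1 c p.2 i)) ((Measure.pi fun _ => D).prod ρ)) (i j : Fin n) :
    ∫ p : (Fin n → Item J K) × Θ, f (p.1 i) (s.solve n p.1 c p.2 i)
        ∂((Measure.pi fun _ => D).prod ρ) =
      ∫ p : (Fin n → Item J K) × Θ, f (p.1 j) (s.solve n p.1 c p.2 j)
        ∂((Measure.pi fun _ => D).prod ρ) := by
  classical
  have hsum : ∀ (i : Fin n) (w : Fin n → Item J K), ∫ θ, f (w i) (s.solve n w c θ i) ∂ρ =
      ∑ x : Fin n → Action J, ρ.real {θ | s.solve n w c θ = x} * f (w i) (x i) := by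
    intro i w
    have hms : ∀ x, MeasurableSet {θ | s.solve n w c θ = x} := fun x =>
      (measurable_const.prodMk (measurable_const.prodMk measurable_id) :
        Measurable fun θ : Θ => (w, c, θ)) (s.measurable_solve n x)
    have : (fun θ => f (w i) (s.solve n w c θ i)) = fun θ => ∑ x : Fin n → Action J,
        {θ | s.solve n w c θ = x}.indicator (fun _ => f (w i) (x i)) θ := by
      funext θ
      simp [Set.indicator_apply]
    rw [this, integral_finsetSum _ fun x _ => (integrable_const _).indicator (hms x)]
    exact Finset.sum_congr rfl fun x _ => by rw [integral_indicator_const _ (hms x), smul_eq_mul]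
  have hperm := measurePreserving_comp_injective D (Equiv.swap i j).injective
  rw [integral_prod _ (hint i), integral_prod _ (hint j)]
  nth_rewrite 1 [← hperm.map_eq]
  rw [integral_map hperm.measurable.aemeasurable
    (by rw [hperm.map_eq]; exact (hint i).integral_prod_left.aestronglyMeasurable)]
  refine integral_congr_ae ?_
  filter_upwards [hs n c] with w hw
  -- Reindexing the plans by the swap makes the two sums agree term by term.
  rw [hsum, hsum, ← (Equiv.arrowCongr (Equiv.swap i j) (Equiv.refl (Action J))).sum_comp]
  refine Finset.sum_congr rfl fun x _ => ?_
  have h := hw (Equiv.swap i j) x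
  have e : (Equiv.arrowCongr (Equiv.swap i j) (Equiv.refl (Action J))) x =
      x ∘ Equiv.swap i j := by
    funext l; simp [Equiv.arrowCongr]
  have e' : ρ.real {θ | s.solve n (w ∘ Equiv.swap i j) c θ = x ∘ Equiv.swap i j} =
      ρ.real {θ | s.solve n w c θ = x} := congrArg ENNReal.toReal h
  rw [e, e']
  simp

/-- The items of an offline program contribute equally to its expected value. -/
theorem Solver.IsEquivariant.integral_reward (hs : s.IsEquivariant ρ D)
    (hr : ∀ j, Integrable (fun ξ : Item J K => ξ.1 j) D) {c : K → ℝ} (hc : ∀ k, 0 ≤ c k)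
    (i : Fin n) :
    n * ∫ p : (Fin n → Item J K) × Θ, reward (p.1 i) (s.solve n p.1 c p.2 i)
        ∂((Measure.pi fun _ => D).prod ρ) = expectedOPT D n c := by
  have hint : ∀ i, Integrable (fun p : (Fin n → Item J K) × Θ =>
      reward (p.1 i) (s.solve n p.1 c p.2 i)) ((Measure.pi fun _ => D).prod ρ) := fun i =>
    integrable_reward hr (measurePreserving_item i)
      (s.measurable_program c measurable_reward i)
  have h : ∀ p : (Fin n → Item J K) × Θ,
      ∑ l, reward (p.1 l) (s.solve n p.1 c p.2 l) = OPT p.1 c := fun p =>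
    (s.isOptimal hc p.1 p.2).OPT_eq.symm
  have hO : Integrable (fun p : (Fin n → Item J K) × Θ => OPT p.1 c)
      ((Measure.pi fun _ => D).prod ρ) := by
    simpa only [h] using integrable_finsetSum Finset.univ fun l _ => hint l
  calc _ = ∑ l : Fin n, ∫ p : (Fin n → Item J K) × Θ, reward (p.1 l) (s.solve n p.1 c p.2 l)
        ∂((Measure.pi fun _ => D).prod ρ) := by
        rw [Finset.sum_congr rfl fun l _ => hs.integral_eq c hint l i]; simp
    _ = ∫ p : (Fin n → Item J K) × Θ, OPT p.1 c ∂((Measure.pi fun _ => D).prod ρ) := by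
        rw [← integral_finsetSum _ fun l _ => hint l]; simp only [h]
    _ = _ := by
        rw [integral_prod _ hO]
        simp [expectedOPT]

/-- The items of an offline program use equal shares of the capacities in expectation. -/
theorem Solver.IsEquivariant.integral_usage_le (hs : s.IsEquivariant ρ D)
    (hA : ∀ᵐ ξ ∂D, ∀ j k, 0 ≤ ξ.2 j k) {c : K → ℝ} (hc : ∀ k, 0 ≤ c k) (k : K) (i : Fin n) :
    n * ∫ p : (Fin n → Item J K) × Θ, usage (p.1 i) (s.solve n p.1 c p.2 i) k
        ∂((Measure.pi fun _ => D).prod ρ) ≤ c k := by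
  have hint : ∀ i, Integrable (fun p : (Fin n → Item J K) × Θ =>
      usage (p.1 i) (s.solve n p.1 c p.2 i) k) ((Measure.pi fun _ => D).prod ρ) := fun i =>
    integrable_usage hA hc k i
  calc _ = ∑ l : Fin n, ∫ p : (Fin n → Item J K) × Θ, usage (p.1 l) (s.solve n p.1 c p.2 l) k
        ∂((Measure.pi fun _ => D).prod ρ) := by
        rw [Finset.sum_congr rfl fun l _ =>
          hs.integral_eq (f := fun ξ a => usage ξ a k) c hint l i]; simp
    _ = ∫ p : (Fin n → Item J K) × Θ, ∑ l, usage (p.1 l) (s.solve n p.1 c p.2 l) k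
        ∂((Measure.pi fun _ => D).prod ρ) := (integral_finsetSum _ fun l _ => hint l).symm
    _ ≤ ∫ _ : (Fin n → Item J K) × Θ, c k ∂((Measure.pi fun _ => D).prod ρ) :=
        integral_mono (integrable_finsetSum _ fun l _ => hint l) (integrable_const _)
          fun p => (s.isOptimal hc p.1 p.2).1 k
    _ = c k := by simp

/-- With the seed frozen, the optimum is the total reward of a measurably chosen plan. -/
theorem integrable_OPT (s : Solver J K Θ) (θ : Θ)
    (hr : ∀ j, Integrable (fun ξ : Item J K => ξ.1 j) D) {c : K → ℝ} (hc : ∀ k, 0 ≤ c k) :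
    Integrable (fun w : Fin n → Item J K => OPT w c) (Measure.pi fun _ => D) := by
  have h : (fun w : Fin n → Item J K => OPT w c) =
      fun w => ∑ l, reward (w l) (s.solve n w c θ l) :=
    funext fun w => (s.isOptimal hc w θ).OPT_eq
  rw [h]
  exact integrable_finsetSum _ fun l _ =>
    integrable_reward hr (measurePreserving_eval (fun _ => D) l)
      (s.measurable_comp measurable_id measurable_const measurable_const measurable_reward l)

end Program

/-! ### Second moments of a truncated walk -/

/-- A one-step second moment bound for the positive part of a random walk. -/
theorem integral_posPart_sq_le {X : Type} [MeasurableSpace X] {P : Measure X}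
    [IsProbabilityMeasure P] {u : X → ℝ} (hu : AEStronglyMeasurable u P) {M v z l : ℝ}
    (hl : 0 ≤ l) (h0 : ∀ᵐ p ∂P, 0 ≤ u p) (hM : ∀ᵐ p ∂P, u p ≤ M) (hv : ∫ p, u p ∂P ≤ v) :
    Integrable (fun p => max (z + l * (u p - v)) 0 ^ 2) P ∧
    ∫ p, max (z + l * (u p - v)) 0 ^ 2 ∂P ≤ max z 0 ^ 2 + l ^ 2 * (M * v) := by
  set e := ∫ p, u p ∂P with he
  have hui : Integrable u P := Integrable.of_bound hu M (by
    filter_upwards [h0, hM] with p h1 h2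
    rwa [Real.norm_eq_abs, abs_of_nonneg h1])
  have hu2 : Integrable (fun p => u p ^ 2) P := Integrable.of_bound (hu.pow 2) (M ^ 2) (by
    filter_upwards [h0, hM] with p h1 h2
    rw [Real.norm_eq_abs, abs_of_nonneg (sq_nonneg _)]
    exact pow_le_pow_left₀ h1 h2 2)
  have hM0 : 0 ≤ M := by
    obtain ⟨p, h1, h2⟩ := (h0.and hM).exists
    exact h1.trans h2
  have hb : ∀ p, max (z + l * (u p - v)) 0 ^ 2 ≤ (max z 0 ^ 2 - 2 * max z 0 * l * e + l ^ 2 * e ^ 2)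
      + (2 * max z 0 * l - 2 * l ^ 2 * e) * u p + l ^ 2 * u p ^ 2 := by
    intro p
    -- Recentring at the true mean `e ≤ v` only increases the walk; in the square the cross term
    -- then has mean zero and only a variance remains.
    have h1 : max (z + l * (u p - v)) 0 ≤ |max z 0 + l * (u p - e)| := by
      refine max_le ((le_abs_self _).trans' ?_) (abs_nonneg _)
      have := le_max_left z 0
      have := mul_le_mul_of_nonneg_left hv hl
      linarith
    have h2 := pow_le_pow_left₀ (le_max_right _ _) h1 2
    rw [sq_abs] at h2
    nlinarith
  have hbi : Integrable (fun p => (max z 0 ^ 2 - 2 * max z 0 * l * e + l ^ 2 * e ^ 2)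
      + (2 * max z 0 * l - 2 * l ^ 2 * e) * u p + l ^ 2 * u p ^ 2) P :=
    ((integrable_const _).add (hui.const_mul _)).add (hu2.const_mul _)
  have hi : Integrable (fun p => max (z + l * (u p - v)) 0 ^ 2) P := by
    refine hbi.mono' ?_ (ae_of_all _ fun p => ?_)
    · exact ((((hu.sub aestronglyMeasurable_const).const_mul l).const_add z).sup
        aestronglyMeasurable_const).pow 2
    · rw [Real.norm_eq_abs, abs_of_nonneg (sq_nonneg _)]
      exact hb p
  refine ⟨hi, (integral_mono hi hbi hb).trans ?_⟩
  -- Since `0 ≤ u ≤ M`, the variance is linear in `M`; this is where small items help.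
  have h2 : ∫ p, u p ^ 2 ∂P ≤ M * e := by
    rw [he, ← integral_const_mul]
    refine integral_mono_ae hu2 (hui.const_mul _) ?_
    filter_upwards [h0, hM] with p h1 h2
    nlinarith
  rw [integral_add (f := fun p => (max z 0 ^ 2 - 2 * max z 0 * l * e + l ^ 2 * e ^ 2)
      + (2 * max z 0 * l - 2 * l ^ 2 * e) * u p) ((integrable_const _).add (hui.const_mul _))
      (hu2.const_mul _), integral_add (integrable_const _) (hui.const_mul _), integral_const_mul, integral_const_mul,
    ← he]
  simp only [integral_const, probReal_univ, one_smul]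
  have h3 : l ^ 2 * ∫ p, u p ^ 2 ∂P ≤ l ^ 2 * (M * v) :=
    mul_le_mul_of_nonneg_left (h2.trans (mul_le_mul_of_nonneg_left hv hM0)) (sq_nonneg _)
  nlinarith [mul_nonneg (sq_nonneg l) (sq_nonneg e)]

end OnlineAlloc
-- Lower bound for the offline optimum from a stationary policy
namespace OnlineAlloc

variable {J K Θ : Type} {n : ℕ}

theorem measurePreserving_cons {D : Measure (Item J K)} [IsProbabilityMeasure D] {X : Type}
    [MeasurableSpace X] {P : Measure X} [IsProbabilityMeasure P] {ξ : X → Item J K}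
    (hξ : MeasurePreserving ξ P D) :
    MeasurePreserving (fun q : X × (Fin n → Item J K) =>
      (Fin.cons (ξ q.1) q.2 : Fin (n + 1) → Item J K))
      (P.prod (Measure.pi fun _ => D)) (Measure.pi fun _ => D) := by
  have h := (measurePreserving_piFinSuccAbove (fun _ : Fin (n + 1) => D) 0).symm.comp
    (hξ.prod (MeasurePreserving.id (Measure.pi fun _ : Fin n => D)))
  convert h using 1
  funext q
  exact (Fin.insertNth_zero' _ _).symm

/-- Penalty for following a stationary random policy for `m` steps under the capacities `c`, when a
step uses at most `M` and on average at most `v`, and a reserve `α` is kept. -/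
noncomputable def shortfall [Fintype K] (M v α : K → ℝ) (m : ℕ) (c : K → ℝ) : ℝ :=
  ∑ k, (max (α k + m * v k - c k) 0 ^ 2 + m * (M k * v k)) / (α k - M k) ^ 2

/-- A random policy which handles single items gives a lower bound for the offline optimum. -/
theorem le_expectedOPT_of_policy [Fintype J] [Fintype K] [MeasurableSpace Θ]
    (s : Solver J K Θ) (θ : Θ) {D : Measure (Item J K)} [IsProbabilityMeasure D]
    (hr : ∀ j, Integrable (fun ξ : Item J K => ξ.1 j) D)
    {X : Type} [MeasurableSpace X] {P : Measure X} [IsProbabilityMeasure P]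
    {ξ : X → Item J K} (hξ : MeasurePreserving ξ P D) {a : X → Action J}
    (hrm : Measurable fun p => reward (ξ p) (a p))
    (hum : ∀ k, AEStronglyMeasurable (fun p => usage (ξ p) (a p) k) P)
    {M v α : K → ℝ} (hα : ∀ k, M k < α k)
    (hu0 : ∀ᵐ p ∂P, ∀ k, 0 ≤ usage (ξ p) (a p) k)
    (huM : ∀ᵐ p ∂P, ∀ k, usage (ξ p) (a p) k ≤ M k)
    (huv : ∀ k, ∫ p, usage (ξ p) (a p) k ∂P ≤ v k)
    (hR : 0 ≤ ∫ p, reward (ξ p) (a p) ∂P) (m : ℕ) {c : K → ℝ} (hc : ∀ k, 0 ≤ c k) :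
    m * (∫ p, reward (ξ p) (a p) ∂P) * (1 - shortfall M v α m c) ≤ expectedOPT D (n + m) c := by
  set R := ∫ p, reward (ξ p) (a p) ∂P with hRdef
  have hM0 : ∀ k, 0 ≤ M k := fun k => by
    obtain ⟨p, h1, h2⟩ := (hu0.and huM).exists
    exact (h1 k).trans (h2 k)
  have hv0 : ∀ k, 0 ≤ v k := fun k =>
    (integral_nonneg_of_ae (by filter_upwards [hu0] with p hp using hp k)).trans (huv k)
  have hnn : ∀ (m : ℕ) (c : K → ℝ) (k : K),
      0 ≤ (max (α k + m * v k - c k) 0 ^ 2 + m * (M k * v k)) / (α k - M k) ^ 2 := fun m c k =>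
    div_nonneg (add_nonneg (sq_nonneg _)
      (mul_nonneg (Nat.cast_nonneg _) (mul_nonneg (hM0 k) (hv0 k)))) (sq_nonneg _)
  induction m generalizing c with
  | zero => simpa using expectedOPT_nonneg hc D
  | succ m ih =>
    -- If every capacity admits one more step, apply the policy to the first item and use induction
    -- on the rest; the penalty does not increase in mean. The `n` surplus items are never touched.
    by_cases hcM : ∀ k, M k ≤ c k
    · have hΦ := measurePreserving_cons (n := n + m) hξ
      have hO := integrable_OPT (n := n + m + 1) (D := D) s θ hr hc
      have hOΦ : Integrable (fun q : X × (Fin (n + m) → Item J K) =>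
          OPT (Fin.cons (ξ q.1) q.2 : Fin (n + m + 1) → Item J K) c)
          (P.prod (Measure.pi fun _ => D)) :=
        (hΦ.integrable_comp hO.aestronglyMeasurable).2 hO
      have hE : expectedOPT D (n + (m + 1)) c = ∫ p, ∫ w : Fin (n + m) → Item J K,
          OPT (Fin.cons (ξ p) w : Fin (n + m + 1) → Item J K) c ∂(Measure.pi fun _ => D) ∂P := by
        rw [← integral_prod _ hOΦ]
        change ∫ w : Fin (n + m + 1) → Item J K, OPT w c ∂(Measure.pi fun _ => D) = _
        rw [← hΦ.map_eq, integral_map hΦ.measurable.aemeasurable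
          (by rw [hΦ.map_eq]; exact hO.aestronglyMeasurable)]
      have hstep : ∀ k, Integrable (fun p => max (α k + m * v k -
          (c - usage (ξ p) (a p)) k) 0 ^ 2) P ∧
          ∫ p, max (α k + m * v k - (c - usage (ξ p) (a p)) k) 0 ^ 2 ∂P ≤
            max (α k + (m + 1 : ℕ) * v k - c k) 0 ^ 2 + M k * v k := by
        intro k
        -- One step replaces `c` by `c - u` and removes one `v` from the planned consumption, so the
        -- walk moves by `u - v`; its variance is paid by one term `M * v` of the penalty.
        have h := integral_posPart_sq_le (z := α k + (m + 1 : ℕ) * v k - c k) (hum k) zero_le_one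
          (by filter_upwards [hu0] with p hp using hp k)
          (by filter_upwards [huM] with p hp using hp k) (huv k)
        have e : ∀ p, α k + (m + 1 : ℕ) * v k - c k + 1 * (usage (ξ p) (a p) k - v k) =
            α k + m * v k - (c - usage (ξ p) (a p)) k := fun p => by
          simp only [Pi.sub_apply]; push_cast; ring
        simp only [e] at h
        simpa only [one_pow, one_mul] using h
      have hri := integrable_reward hr hξ hrm
      have hki : ∀ k, Integrable (fun p => (max (α k + m * v k - (c - usage (ξ p) (a p)) k) 0 ^ 2
          + m * (M k * v k)) / (α k - M k) ^ 2) P := fun k =>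
        ((hstep k).1.add (integrable_const _)).div_const _
      have hSi : Integrable (fun p => shortfall M v α m (c - usage (ξ p) (a p))) P :=
        integrable_finsetSum _ fun k _ => hki k
      have hS : ∫ p, shortfall M v α m (c - usage (ξ p) (a p)) ∂P ≤ shortfall M v α (m + 1) c := by
        unfold shortfall
        rw [integral_finsetSum _ fun k _ => hki k]
        refine Finset.sum_le_sum fun k _ => ?_
        rw [integral_div, integral_add (hstep k).1 (integrable_const _)]
        refine div_le_div_of_nonneg_right ?_ (sq_nonneg _)
        have := (hstep k).2
        simp only [integral_const, probReal_univ, one_smul]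
        push_cast at this ⊢
        linarith
      have hbi : Integrable (fun p => m * R * (1 - shortfall M v α m (c - usage (ξ p) (a p)))) P :=
        ((integrable_const _).sub hSi).const_mul _
      have hlow : ∫ p, (reward (ξ p) (a p) +
          m * R * (1 - shortfall M v α m (c - usage (ξ p) (a p)))) ∂P ≤
          expectedOPT D (n + (m + 1)) c := by
        rw [hE]
        refine integral_mono_ae (hri.add hbi)
          hOΦ.integral_prod_left ?_
        filter_upwards [huM, hOΦ.prod_right_ae] with p hp hi
        have hc' : ∀ k, 0 ≤ (c - usage (ξ p) (a p)) k := fun k =>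
          sub_nonneg.2 ((hp k).trans (hcM k))
        have hi' := integrable_OPT (n := n + m) (D := D) s θ hr hc'
        calc _ ≤ reward (ξ p) (a p) + expectedOPT D (n + m) (c - usage (ξ p) (a p)) :=
              add_le_add_right (ih hc') _
          _ = ∫ w : Fin (n + m) → Item J K, (reward (ξ p) (a p) +
                OPT w (c - usage (ξ p) (a p))) ∂(Measure.pi fun _ => D) := by
              rw [integral_add (integrable_const _) hi']
              simp [expectedOPT]
          _ ≤ _ := integral_mono ((integrable_const _).add hi') hi fun w =>
              reward_add_OPT_le (ξ p) w (a p) fun k => (hp k).trans (hcM k)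
      refine le_trans ?_ hlow
      rw [integral_add hri hbi, integral_const_mul,
        integral_sub (integrable_const _) hSi, ← hRdef]
      simp only [integral_const, probReal_univ, one_smul]
      have h0 : 0 ≤ shortfall M v α (m + 1) c := Finset.sum_nonneg fun k _ => hnn _ _ k
      have h1 : (m : ℝ) * R * ∫ p, shortfall M v α m (c - usage (ξ p) (a p)) ∂P ≤
          m * R * shortfall M v α (m + 1) c :=
        mul_le_mul_of_nonneg_left hS (mul_nonneg (Nat.cast_nonneg _) hR)
      have h2 := mul_nonneg hR h0
      push_cast
      linarith
    -- Some `c k < M k`, so the positive part exceeds `α k - M k` and the penalty is at least 1: the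
    -- claimed lower bound is nonpositive.
    · push Not at hcM
      obtain ⟨k, hk⟩ := hcM
      have h1 : 1 ≤ shortfall M v α (m + 1) c := by
        refine le_trans ?_ (Finset.single_le_sum (fun k _ => hnn (m + 1) c k) (Finset.mem_univ k))
        rw [le_div_iff₀ (pow_pos (sub_pos.2 (hα k)) 2), one_mul]
        refine le_add_of_le_of_nonneg (pow_le_pow_left₀ (sub_pos.2 (hα k)).le ?_ 2)
          (mul_nonneg (Nat.cast_nonneg _) (mul_nonneg (hM0 k) (hv0 k)))
        have := mul_nonneg (Nat.cast_nonneg (α := ℝ) (m + 1)) (hv0 k)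
        exact le_max_of_le_left (by linarith)
      exact (mul_nonpos_of_nonneg_of_nonpos (mul_nonneg (Nat.cast_nonneg _) hR)
        (by linarith)).trans (expectedOPT_nonneg hc D)

end OnlineAlloc
-- Paths of OSO and conditioning on the past by resampling one period
namespace OnlineAlloc

variable {J K Θ : Type} {T : ℕ}

theorem window_update_of_ne (ω : Outcome J K Θ T) {t t' : Fin T} (h : t' ≠ t)
    (q : (Fin T → Item J K) × Θ) :
    Outcome.window (Function.update ω t q) t' = ω.window t' := by
  funext i
  simp only [Outcome.window, Function.update_of_ne h]

/-- The items of the program of period `t` and the seed, as a function of the randomness of that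
period. -/
def windowSeed (t : Fin T) (q : (Fin T → Item J K) × Θ) : (Fin (T - t.1) → Item J K) × Θ :=
  (fun i => q.1 ⟨t.1 + i.1, by omega⟩, q.2)

theorem window_update_self (ω : Outcome J K Θ T) (t : Fin T) (q : (Fin T → Item J K) × Θ) :
    Outcome.window (Function.update ω t q) t = (windowSeed t q).1 := by
  funext i
  simp only [Outcome.window, windowSeed, Function.update_self]

section Path
variable [MeasurableSpace Θ] {s : Solver J K Θ} {b : K → ℝ}

theorem osoOccupancy_succ (ω : Outcome J K Θ T) (t : Fin T) :
    osoOccupancy s b ω (t + 1) = osoOccupancy s b ω t +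
      usage (ω.arrival t) (osoDecision s b ω (osoOccupancy s b ω t) t) := by
  simp [osoOccupancy]

theorem osoOccupancy_eq_sum (ω : Outcome J K Θ T) (k : K) :
    osoOccupancy s b ω T k = ∑ t : Fin T,
      usage (ω.arrival t) (osoDecision s b ω (osoOccupancy s b ω t) t) k := by
  have h : ∀ n (hn : n ≤ T), osoOccupancy s b ω n k = ∑ t : Fin n,
      usage (ω.arrival (t.castLE hn))
        (osoDecision s b ω (osoOccupancy s b ω t) (t.castLE hn)) k := by
    intro n
    induction n with
    | zero => intro _; simp [osoOccupancy]
    | succ n ih =>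
      intro hn
      rw [osoOccupancy_succ ω ⟨n, hn⟩, Pi.add_apply, ih (Nat.le_of_succ_le hn),
        Fin.sum_univ_castSucc]
      rfl
  exact h T le_rfl

/-- Remaining capacities never become negative, so rejecting everything keeps every program feasible
and the solver's guarantee always applies. -/
theorem osoOccupancy_mem (hb : ∀ k, 0 ≤ b k) {ω : Outcome J K Θ T}
    (hω : ∀ t i j k, 0 ≤ ((ω t).1 i).2 j k) (t : ℕ) (k : K) :
    0 ≤ osoOccupancy s b ω t k ∧ osoOccupancy s b ω t k ≤ b k := by
  induction t generalizing k with
  | zero => exact ⟨le_rfl, hb k⟩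
  | succ t ih =>
    by_cases h : t < T
    · have h' := osoOccupancy_succ (s := s) (b := b) ω ⟨t, h⟩
      rw [h', Pi.add_apply]
      have hu := (s.isOptimal (b := b - osoOccupancy s b ω t) (fun k => sub_nonneg.2 (ih k).2)
        (ω.window ⟨t, h⟩) (ω ⟨t, h⟩).2).1.usage_le (fun i j k => hω _ _ j k)
        ⟨0, by simp; omega⟩ k
      have hu0 := usage_nonneg (hω ⟨t, h⟩ ⟨t, h⟩)
        (osoDecision s b ω (osoOccupancy s b ω t) ⟨t, h⟩) k
      exact ⟨add_nonneg (ih k).1 hu0, le_sub_iff_add_le'.1 hu⟩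
    · simpa [osoOccupancy, h] using ih k

/-- Nonanticipation: the past of period `t` ignores the randomness of that period. -/
theorem osoOccupancy_update (ω : Outcome J K Θ T) (t : Fin T) (q : (Fin T → Item J K) × Θ)
    {n : ℕ} (hn : n ≤ t) :
    osoOccupancy s b (Function.update ω t q) n = osoOccupancy s b ω n := by
  induction n with
  | zero => rfl
  | succ n ih =>
    have hnT : n < T := by omega
    have hne : (⟨n, hnT⟩ : Fin T) ≠ t := by
      rintro rfl
      simp at hn
    rw [osoOccupancy_succ _ ⟨n, hnT⟩, osoOccupancy_succ _ ⟨n, hnT⟩]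
    simp only [ih (by omega), Outcome.arrival, osoDecision, window_update_of_ne _ hne,
      Function.update_of_ne hne]

theorem osoReward_le_OPT [Finite J] (hb : ∀ k, 0 ≤ b k) {ω : Outcome J K Θ T}
    (hω : ∀ t i j k, 0 ≤ ((ω t).1 i).2 j k) :
    osoReward s b ω ≤ OPT ω.arrival b := by
  refine le_OPT (w := ω.arrival)
    (x := fun t => osoDecision s b ω (osoOccupancy s b ω t) t) fun k => ?_
  rw [← osoOccupancy_eq_sum]
  exact (osoOccupancy_mem hb hω T k).2

variable [Finite J]

theorem measurable_oso_comp (t : Fin T)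
    (hS : Measurable fun ω : Outcome J K Θ T => osoOccupancy s b ω t)
    {f : Item J K → Action J → ℝ} (hf : ∀ a, Measurable fun ξ => f ξ a) :
    Measurable fun ω : Outcome J K Θ T =>
      f (ω.arrival t) (osoDecision s b ω (osoOccupancy s b ω t) t) :=
  s.measurable_comp (n := T - t) (w := fun ω => Outcome.window ω t)
    (b := fun ω => b - osoOccupancy s b ω t) (θ := fun ω => (ω t).2)
    (measurable_pi_lambda _ fun i => by unfold Outcome.window; fun_prop)
    (measurable_const.sub hS) (by fun_prop) hf ⟨0, by omega⟩

theorem measurable_osoOccupancy (n : ℕ) :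
    Measurable fun ω : Outcome J K Θ T => osoOccupancy s b ω n := by
  induction n with
  | zero => exact measurable_const
  | succ n ih =>
    by_cases h : n < T
    · simp only [osoOccupancy_succ _ (⟨n, h⟩ : Fin T)]
      exact ih.add (measurable_pi_iff.2 fun k =>
        measurable_oso_comp ⟨n, h⟩ ih fun a => measurable_usage a k)
    · simpa [osoOccupancy, h] using ih

end Path

section Law
variable [MeasurableSpace Θ] {D : Measure (Item J K)} [IsProbabilityMeasure D]
  {ρ : Measure Θ} [IsProbabilityMeasure ρ]

instance : IsProbabilityMeasure (outcomeLaw D ρ T) := by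
  unfold outcomeLaw; infer_instance

theorem ae_outcome {p : Item J K → Prop} (hA : ∀ᵐ ξ ∂D, p ξ) :
    ∀ᵐ ω ∂(outcomeLaw D ρ T), ∀ t i, p ((ω t).1 i) :=
  ae_all_iff.2 fun t => (measurePreserving_eval
    (fun _ : Fin T => (Measure.pi fun _ : Fin T => D).prod ρ) t).quasiMeasurePreserving.ae
      (ae_items hA)

theorem measurePreserving_arrival :
    MeasurePreserving (fun ω : Outcome J K Θ T => ω.arrival) (outcomeLaw D ρ T)
      (Measure.pi fun _ => D) :=
  measurePreserving_pi (fun _ : Fin T => (Measure.pi fun _ : Fin T => D).prod ρ) (fun _ => D)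
    fun t => measurePreserving_item t

theorem measurePreserving_windowSeed (t : Fin T) :
    MeasurePreserving (windowSeed (J := J) (K := K) (Θ := Θ) t)
      ((Measure.pi fun _ => D).prod ρ) ((Measure.pi fun _ => D).prod ρ) :=
  (measurePreserving_comp_injective D (e := fun i : Fin (T - t.1) => (⟨t.1 + i.1, by omega⟩ : Fin T))
    fun i j h => Fin.ext (by simpa using h)).prod (MeasurePreserving.id ρ)

/-- Stands in for conditional expectation: the inner integral averages over period `t` with all
other periods fixed. -/
theorem integral_update {F : Outcome J K Θ T → ℝ} (hF : Integrable F (outcomeLaw D ρ T))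
    (t : Fin T) :
    Integrable (fun ω => ∫ q, F (Function.update ω t q) ∂((Measure.pi fun _ => D).prod ρ))
      (outcomeLaw D ρ T) ∧
    ∫ ω, F ω ∂(outcomeLaw D ρ T) =
      ∫ ω, ∫ q, F (Function.update ω t q) ∂((Measure.pi fun _ => D).prod ρ)
        ∂(outcomeLaw D ρ T) := by
  have h := measurePreserving_update (ι := Fin T) ((Measure.pi fun _ : Fin T => D).prod ρ) t
  have hi := (h.integrable_comp hF.aestronglyMeasurable).2 hF
  refine ⟨hi.integral_prod_left, ?_⟩
  refine Eq.trans ?_ (integral_prod _ hi)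
  rw [outcomeLaw]
  conv_lhs => rw [← h.map_eq]
  exact integral_map h.measurable.aemeasurable (by rw [h.map_eq]; exact hF.aestronglyMeasurable)

variable [Fintype J] {s : Solver J K Θ} {b : K → ℝ}

theorem integrable_oso_reward (hr : ∀ j, Integrable (fun ξ : Item J K => ξ.1 j) D) (t : Fin T) :
    Integrable (fun ω => reward (ω.arrival t) (osoDecision s b ω (osoOccupancy s b ω t) t))
      (outcomeLaw D ρ T) :=
  integrable_reward hr ((measurePreserving_eval (fun _ => D) t).comp measurePreserving_arrival)
    (measurable_oso_comp t (measurable_osoOccupancy t) measurable_reward)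

theorem expectedOSO_eq_sum (hr : ∀ j, Integrable (fun ξ : Item J K => ξ.1 j) D) :
    expectedOSO s ρ D T b = ∑ t : Fin T, ∫ ω, reward (ω.arrival t)
      (osoDecision s b ω (osoOccupancy s b ω t) t) ∂(outcomeLaw D ρ T) :=
  integral_finsetSum _ fun t _ => integrable_oso_reward hr t

theorem expectedOSO_le_expectedOPT (hr : ∀ j, Integrable (fun ξ : Item J K => ξ.1 j) D)
    (hA : ∀ᵐ ξ ∂D, ∀ j k, 0 ≤ ξ.2 j k) (hb : ∀ k, 0 ≤ b k) :
    expectedOSO s ρ D T b ≤ expectedOPT D T b := by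
  obtain ⟨θ⟩ : Nonempty Θ := nonempty_of_isProbabilityMeasure ρ
  have hO := integrable_OPT (n := T) (D := D) s θ hr hb
  have hp := measurePreserving_arrival (D := D) (ρ := ρ) (T := T)
  have hE : expectedOPT D T b = ∫ ω, OPT (Outcome.arrival ω) b ∂(outcomeLaw D ρ T) := by
    rw [expectedOPT, ← hp.map_eq, integral_map hp.measurable.aemeasurable
      (by rw [hp.map_eq]; exact hO.aestronglyMeasurable)]
  rw [hE]
  refine integral_mono_ae (integrable_finsetSum _ fun t _ => integrable_oso_reward hr t)
    ((hp.integrable_comp hO.aestronglyMeasurable).2 hO) ?_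
  filter_upwards [ae_outcome hA] with ω hω
  exact osoReward_le_OPT hb hω

/-- The expected reward of OSO in a period is the expected average reward of the program solved. -/
theorem integral_oso_reward (hs : s.IsEquivariant ρ D)
    (hr : ∀ j, Integrable (fun ξ : Item J K => ξ.1 j) D)
    (hA : ∀ᵐ ξ ∂D, ∀ j k, 0 ≤ ξ.2 j k) (hb : ∀ k, 0 ≤ b k) (t : Fin T) :
    Integrable (fun ω => expectedOPT D (T - t) (b - osoOccupancy s b ω t)) (outcomeLaw D ρ T) ∧
    (T - t : ℕ) * ∫ ω, reward (ω.arrival t) (osoDecision s b ω (osoOccupancy s b ω t) t)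
      ∂(outcomeLaw D ρ T) =
    ∫ ω, expectedOPT D (T - t) (b - osoOccupancy s b ω t) ∂(outcomeLaw D ρ T) := by
  obtain ⟨h1, h2⟩ := integral_update (integrable_oso_reward (s := s) (b := b) (ρ := ρ) hr t) t
  -- With the occupancy frozen, the inner integral is the mean reward of the first item in a program
  -- with deterministic capacities.
  have key : (fun ω : Outcome J K Θ T => (T - t : ℕ) * ∫ q,
      reward (Outcome.arrival (Function.update ω t q) t) (osoDecision s b (Function.update ω t q)
        (osoOccupancy s b (Function.update ω t q) t) t) ∂((Measure.pi fun _ => D).prod ρ))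
      =ᵐ[outcomeLaw D ρ T] fun ω => expectedOPT D (T - t) (b - osoOccupancy s b ω t) := by
    filter_upwards [ae_outcome hA] with ω hω
    have hc : ∀ k, 0 ≤ (b - osoOccupancy s b ω t) k := fun k =>
      sub_nonneg.2 (osoOccupancy_mem hb hω t k).2
    rw [← hs.integral_reward hr hc ⟨0, by omega⟩]
    have hp := measurePreserving_windowSeed (J := J) (K := K) (D := D) (ρ := ρ) t
    rw [← hp.map_eq, integral_map hp.measurable.aemeasurable
      (s.measurable_program _ measurable_reward _).aestronglyMeasurable]
    simp only [osoOccupancy_update _ _ _ le_rfl, Outcome.arrival, osoDecision, window_update_self,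
      Function.update_self]
    rfl
  refine ⟨(h1.const_mul _).congr key, ?_⟩
  rw [h2, ← integral_const_mul]
  exact integral_congr_ae key

end Law

end OnlineAlloc
-- Capacity per remaining period, and the reward of a single period
namespace OnlineAlloc

variable {J K Θ : Type} {T : ℕ} [MeasurableSpace Θ] {D : Measure (Item J K)}
  [IsProbabilityMeasure D] {ρ : Measure Θ} [IsProbabilityMeasure ρ] [Fintype J]
  {s : Solver J K Θ} {b M : K → ℝ}

/-- The squared shortage of resource `k` per remaining period before period `t`, compared with the
share per period at the start. -/
noncomputable def shortage (s : Solver J K Θ) (b : K → ℝ) (k : K) (t : ℕ)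
    (ω : Outcome J K Θ T) : ℝ :=
  max (b k / T - (b k - osoOccupancy s b ω t k) / (T - t)) 0 ^ 2

theorem integrable_shortage (hA : ∀ᵐ ξ ∂D, ∀ j k, 0 ≤ ξ.2 j k) (hb : ∀ k, 0 ≤ b k) (k : K)
    {t : ℕ} (ht : t ≤ T) : Integrable (shortage (T := T) s b k t) (outcomeLaw D ρ T) := by
  have hm : Measurable (shortage (T := T) s b k t) :=
    ((measurable_const.sub ((measurable_const.sub ((measurable_pi_apply k).comp
      (measurable_osoOccupancy t))).div_const _)).max measurable_const).pow_const 2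
  refine Integrable.of_bound hm.aestronglyMeasurable ((b k / T) ^ 2) ?_
  filter_upwards [ae_outcome hA] with ω hω
  rw [shortage, Real.norm_eq_abs, abs_of_nonneg (sq_nonneg _)]
  have h1 : 0 ≤ (b k - osoOccupancy s b ω t k) / (T - t) :=
    div_nonneg (sub_nonneg.2 (osoOccupancy_mem hb hω t k).2)
      (sub_nonneg.2 (Nat.cast_le.2 ht))
  have h2 : 0 ≤ b k / T := div_nonneg (hb k) (Nat.cast_nonneg _)
  exact pow_le_pow_left₀ (le_max_right _ _) (max_le (by linarith) h2) 2

/-- With n periods left, capacity c and consumption u, the quantity b / T - c / n increases by (u -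
c / n) / (n - 1), whose conditional mean is at most zero. The one-step second moment bound then
applies with l = 1 / (n - 1) and v = c / n ≤ b / n. -/
theorem integral_shortage_succ_le (hs : s.IsEquivariant ρ D)
    (hA : ∀ᵐ ξ ∂D, ∀ j k, 0 ≤ ξ.2 j k) (hM0 : ∀ k, 0 ≤ M k)
    (hM : ∀ᵐ ξ ∂D, ∀ j k, ξ.2 j k ≤ M k) (hb : ∀ k, 0 ≤ b k) (k : K) {t : ℕ} (ht : t + 1 < T) :
    ∫ ω, shortage (T := T) s b k (t + 1) ω ∂(outcomeLaw D ρ T) ≤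
      ∫ ω, shortage (T := T) s b k t ω ∂(outcomeLaw D ρ T) +
        (1 / (T - (t + 1) : ℝ)) ^ 2 * (M k * (b k / (T - t))) := by
  have htT : t < T := by omega
  set τ : Fin T := ⟨t, htT⟩
  have hl : (0 : ℝ) < T - (t + 1) := by
    have : ((t + 1 : ℕ) : ℝ) < T := Nat.cast_lt.2 ht
    push_cast at this; linarith
  have hn : (0 : ℝ) < T - t := by linarith
  obtain ⟨h1, h2⟩ := integral_update
    (integrable_shortage (s := s) (ρ := ρ) (T := T) hA hb k ht.le) τ
  rw [h2]
  have hYi := integrable_shortage (s := s) (ρ := ρ) (T := T) hA hb k htT.le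
  have hc : ∫ ω, shortage (T := T) s b k t ω ∂(outcomeLaw D ρ T) +
      (1 / (T - (t + 1) : ℝ)) ^ 2 * (M k * (b k / (T - t))) =
      ∫ ω, (shortage (T := T) s b k t ω + (1 / (T - (t + 1) : ℝ)) ^ 2 * (M k * (b k / (T - t))))
        ∂(outcomeLaw D ρ T) := by
    rw [integral_add hYi (integrable_const _)]; simp
  rw [hc]
  refine integral_mono_ae h1 (hYi.add (integrable_const _)) ?_
  filter_upwards [ae_outcome hA] with ω hω
  set S := osoOccupancy s b ω t with hS
  have hSb := fun k => osoOccupancy_mem (s := s) hb hω t k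
  have hc' : ∀ k, 0 ≤ (b - S) k := fun k => sub_nonneg.2 (hSb k).2
  set u : (Fin (T - τ) → Item J K) × Θ → ℝ := fun p =>
    usage (p.1 ⟨0, by omega⟩) (s.solve (T - τ) p.1 (b - S) p.2 ⟨0, by omega⟩) k with hu
  have hp := measurePreserving_windowSeed (J := J) (K := K) (D := D) (ρ := ρ) τ
  have hum : Measurable u := s.measurable_program _ (fun a => measurable_usage a k) _
  have huv : ∫ q, u (windowSeed τ q) ∂((Measure.pi fun _ => D).prod ρ) ≤
      (b k - S k) / (T - t) := by
    rw [le_div_iff₀' hn, ← integral_map hp.measurable.aemeasurable hum.aestronglyMeasurable,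
      hp.map_eq]
    have := hs.integral_usage_le hA hc' k (⟨0, by omega⟩ : Fin (T - τ))
    rwa [Nat.cast_sub htT.le] at this
  have hu0 : ∀ᵐ q ∂((Measure.pi fun _ => D).prod ρ), 0 ≤ u (windowSeed τ q) := by
    filter_upwards [ae_items hA] with q hq using usage_nonneg (hq _) _ _
  have huM : ∀ᵐ q ∂((Measure.pi fun _ => D).prod ρ), u (windowSeed τ q) ≤ M k := by
    filter_upwards [ae_items hM] with q hq using usage_le hM0 (hq _) _ _
  have hstep := (integral_posPart_sq_le (z := b k / T - (b k - S k) / (T - t))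
    (hum.comp hp.measurable).aestronglyMeasurable (one_div_nonneg.2 hl.le) hu0 huM huv).2
  have e : ∀ q, shortage s b k (t + 1) (Function.update ω τ q) =
      max (b k / T - (b k - S k) / (T - t) +
        1 / (T - (t + 1) : ℝ) * (u (windowSeed τ q) - (b k - S k) / (T - t))) 0 ^ 2 := by
    intro q
    have hocc : osoOccupancy s b (Function.update ω τ q) (t + 1) k = S k + u (windowSeed τ q) := by
      rw [osoOccupancy_succ _ τ, osoOccupancy_update _ _ _ le_rfl]
      simp only [Outcome.arrival, osoDecision, window_update_self, Function.update_self]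
      rfl
    rw [shortage, hocc]
    congr 2
    push_cast
    field_simp
    ring
  simp only [e]
  refine hstep.trans (add_le_add_right (mul_le_mul_of_nonneg_left
    (mul_le_mul_of_nonneg_left (div_le_div_of_nonneg_right ?_ hn.le) (hM0 k)) (sq_nonneg _)) _)
  linarith [(hSb k).1]

/-- The shortage starts at zero, and while at least `x` periods remain each step adds at most `M k *
b k / x ^ 3`. -/
theorem integral_shortage_le (hs : s.IsEquivariant ρ D)
    (hA : ∀ᵐ ξ ∂D, ∀ j k, 0 ≤ ξ.2 j k) (hM0 : ∀ k, 0 ≤ M k)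
    (hM : ∀ᵐ ξ ∂D, ∀ j k, ξ.2 j k ≤ M k) (hb : ∀ k, 0 ≤ b k) (k : K) {x : ℝ} (hx : 0 < x)
    {t : ℕ} (ht : x ≤ T - t) :
    ∫ ω, shortage (T := T) s b k t ω ∂(outcomeLaw D ρ T) ≤ t * (M k * b k / x ^ 3) := by
  induction t with
  | zero => simp [shortage, osoOccupancy]
  | succ t ih =>
    push_cast at ht
    have htT : t + 1 < T := by
      have : ((t + 1 : ℕ) : ℝ) < T := by push_cast; linarith
      exact_mod_cast this
    refine (integral_shortage_succ_le hs hA hM0 hM hb k htT).trans ?_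
    have h1 : (1 / (T - (t + 1) : ℝ)) ^ 2 ≤ (1 / x) ^ 2 :=
      pow_le_pow_left₀ (one_div_nonneg.2 (by linarith)) (one_div_le_one_div_of_le hx ht) 2
    have h2 : b k / (T - t) ≤ b k / x := div_le_div_of_nonneg_left (hb k) hx (by linarith)
    have h3 : (1 / (T - (t + 1) : ℝ)) ^ 2 * (M k * (b k / (T - t))) ≤
        (1 / x) ^ 2 * (M k * (b k / x)) :=
      mul_le_mul h1 (mul_le_mul_of_nonneg_left h2 (hM0 k))
        (mul_nonneg (hM0 k) (div_nonneg (hb k) (by linarith))) (sq_nonneg _)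
    have h4 : (1 / x) ^ 2 * (M k * (b k / x)) = M k * b k / x ^ 3 := by field_simp
    have := ih (by linarith)
    push_cast
    linarith

variable [Fintype K]

/-- A lower bound for the expected reward of OSO in a period `t` which is not too late. -/
theorem le_integral_oso_reward (hs : s.IsEquivariant ρ D)
    (hr : ∀ j, Integrable (fun ξ : Item J K => ξ.1 j) D)
    (hA : ∀ᵐ ξ ∂D, ∀ j k, 0 ≤ ξ.2 j k) (hb : ∀ k, 0 < b k) {β : ℝ} (hβ : 0 < β)
    (hM : ∀ᵐ ξ ∂D, ∀ j k, ξ.2 j k ≤ b k / β) {δ α : ℝ} (hδ : 0 < δ) (hα : 0 < α)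
    (hαβ : 2 / β ≤ α) (t : Fin T) (ht : δ * T ≤ T - t) (m : ℕ) (hm : α * T + m ≤ T - t) :
    m * (expectedOPT D T b / T) * (1 - Fintype.card K * (4 / α ^ 2 * (1 / δ ^ 3 + 1)) / β) ≤
      (T - t) * ∫ ω, reward (ω.arrival t) (osoDecision s b ω (osoOccupancy s b ω t) t)
        ∂(outcomeLaw D ρ T) := by
  have hT : (0 : ℝ) < T := Nat.cast_pos.2 t.pos
  have hb0 : ∀ k, 0 ≤ b k := fun k => (hb k).le
  have hM0 : ∀ k, 0 ≤ b k / β := fun k => div_nonneg (hb0 k) hβ.le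
  obtain ⟨θ⟩ : Nonempty Θ := nonempty_of_isProbabilityMeasure ρ
  obtain ⟨hVi, hV⟩ := integral_oso_reward (s := s) hs hr hA hb0 t
  rw [Nat.cast_sub t.2.le] at hV
  rw [hV]
  -- The `l ≥ α * T` surplus items leave room for the reserve `α * b k`.
  obtain ⟨l, hl⟩ : ∃ l, T - t = l + m := by
    have : (m : ℝ) + t ≤ T := by nlinarith
    have : m + t ≤ T := by exact_mod_cast this
    exact ⟨T - t - m, by omega⟩
  set P := ((Measure.pi fun _ : Fin T => D).prod ρ) with hP
  set i₀ : Fin T := ⟨0, by omega⟩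
  have hR : ∫ p : (Fin T → Item J K) × Θ, reward (p.1 i₀) (s.solve T p.1 b p.2 i₀) ∂P =
      expectedOPT D T b / T := by
    rw [eq_div_iff hT.ne', mul_comm]
    exact hs.integral_reward hr hb0 i₀
  set R := expectedOPT D T b / T
  have hR0 : 0 ≤ R := div_nonneg (expectedOPT_nonneg hb0 D) hT.le
  -- The reserve is at least twice the largest step, so the Chebyshev denominator is at least `(α *
  -- b k / 2) ^ 2`.
  have hαM : ∀ k, b k / β ≤ α * b k / 2 := fun k => by
    have := mul_le_mul_of_nonneg_right hαβ (hb0 k)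
    have e : 2 / β * b k = 2 * (b k / β) := by ring
    linarith
  have hpol := fun (c : K → ℝ) (hc : ∀ k, 0 ≤ c k) =>
    le_expectedOPT_of_policy (n := l) s θ hr (P := P) (measurePreserving_item i₀)
    (s.measurable_program b measurable_reward i₀)
    (fun k => (s.measurable_program b (fun a => measurable_usage a k) i₀).aestronglyMeasurable)
    (M := fun k => b k / β) (v := fun k => b k / T) (α := fun k => α * b k)
    (fun k => by have := mul_pos hα (hb k); linarith [hαM k])
    (by filter_upwards [ae_items hA] with q hq k using usage_nonneg (hq _) _ _)
    (by filter_upwards [ae_items hM] with q hq k using usage_le hM0 (hq _) _ _)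
    (fun k => by rw [le_div_iff₀' hT]; exact hs.integral_usage_le hA hb0 k i₀)
    (by rw [hR]; exact hR0) m hc
  rw [hR] at hpol
  have hYi : ∀ k, Integrable (shortage (T := T) s b k t) (outcomeLaw D ρ T) := fun k =>
    integrable_shortage hA hb0 k t.2.le
  have hmT : (m : ℝ) ≤ T := by
    have := mul_pos hα hT
    have : (0 : ℝ) ≤ (t : ℕ) := Nat.cast_nonneg _
    linarith
  have hn : (0 : ℝ) < T - t := lt_of_lt_of_le (mul_pos hδ hT) ht
  have hnT : (T - t : ℝ) ≤ T := by
    have : (0 : ℝ) ≤ (t : ℕ) := Nat.cast_nonneg _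
    linarith
  set G : Outcome J K Θ T → ℝ := fun ω =>
    ∑ k, (T ^ 2 * shortage s b k t ω + b k ^ 2 / β) * (4 / (α ^ 2 * b k ^ 2)) with hG
  have hki : ∀ k, Integrable (fun ω => (T ^ 2 * shortage (T := T) s b k t ω + b k ^ 2 / β) *
      (4 / (α ^ 2 * b k ^ 2))) (outcomeLaw D ρ T) := fun k =>
    (((hYi k).const_mul _).add (integrable_const _)).mul_const _
  have hGi : Integrable G (outcomeLaw D ρ T) := integrable_finsetSum _ fun k _ => hki k
  have hle : ∀ ω : Outcome J K Θ T, shortfall (fun k => b k / β) (fun k => b k / T)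
      (fun k => α * b k) m (b - osoOccupancy s b ω t) ≤ G ω := by
    intro ω
    refine Finset.sum_le_sum fun k _ => ?_
    have hbk := hb k
    have hnum : max (α * b k + m * (b k / T) - (b - osoOccupancy s b ω t) k) 0 ^ 2 +
        m * (b k / β * (b k / T)) ≤ T ^ 2 * shortage s b k t ω + b k ^ 2 / β := by
      refine add_le_add ?_ ?_
      · rw [shortage, ← mul_pow]
        refine pow_le_pow_left₀ (le_max_right _ _) (max_le ?_ (by positivity)) 2
        -- Reserve and planned consumption fit into the fair share of the remaining periods, so any
        -- deficit comes from the shortage.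
        have h1 : α * b k + m * (b k / T) - (b - osoOccupancy s b ω t) k ≤
            (T - t) * (b k / T - (b k - osoOccupancy s b ω t k) / (T - t)) := by
          have h2 := mul_le_mul_of_nonneg_right hm (div_nonneg hbk.le hT.le)
          have e1 : (α * T + m) * (b k / T) = α * b k + m * (b k / T) := by field_simp
          have e2 : (T - t : ℝ) * (b k / T - (b k - osoOccupancy s b ω t k) / (T - t)) =
              (T - t) * (b k / T) - (b k - osoOccupancy s b ω t k) := by
            rw [mul_sub, mul_div_cancel₀ _ hn.ne']
          rw [e1] at h2
          rw [e2, Pi.sub_apply]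
          linarith
        exact h1.trans ((mul_le_mul_of_nonneg_left (le_max_left _ _) hn.le).trans
          (mul_le_mul_of_nonneg_right hnT (le_max_right _ _)))
      · have e : (m : ℝ) * (b k / β * (b k / T)) = m / T * (b k ^ 2 / β) := by ring
        rw [e]
        exact mul_le_of_le_one_left (div_nonneg (sq_nonneg _) hβ.le) ((div_le_one hT).2 hmT)
    have hden : (α * b k / 2) ^ 2 ≤ (α * b k - b k / β) ^ 2 :=
      pow_le_pow_left₀ (by positivity) (by linarith [hαM k]) 2
    have h0 : 0 ≤ T ^ 2 * shortage s b k t ω + b k ^ 2 / β :=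
      add_nonneg (mul_nonneg (sq_nonneg _) (sq_nonneg _)) (div_nonneg (sq_nonneg _) hβ.le)
    refine (div_le_div₀ h0 hnum (by positivity) hden).trans (le_of_eq ?_)
    field_simp
    ring
  have hGE : ∫ ω, G ω ∂(outcomeLaw D ρ T) ≤
      Fintype.card K * (4 / α ^ 2 * (1 / δ ^ 3 + 1)) / β := by
    rw [hG, integral_finsetSum _ fun k _ => hki k]
    have : ∀ k ∈ (Finset.univ : Finset K), ∫ ω, (T ^ 2 * shortage (T := T) s b k t ω +
        b k ^ 2 / β) * (4 / (α ^ 2 * b k ^ 2)) ∂(outcomeLaw D ρ T) ≤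
        4 / α ^ 2 * (1 / δ ^ 3 + 1) / β := by
      intro k _
      have hbk := hb k
      rw [integral_mul_const, integral_add ((hYi k).const_mul _) (integrable_const _),
        integral_const_mul]
      have h1 := integral_shortage_le (M := fun k => b k / β) hs hA hM0 hM hb0 k
        (mul_pos hδ hT) ht
      have h2 : (t : ℝ) * (b k / β * b k / (δ * T) ^ 3) ≤
          T * (b k / β * b k / (δ * T) ^ 3) :=
        mul_le_mul_of_nonneg_right (Nat.cast_le.2 t.2.le) (by positivity)
      have h3 := mul_le_mul_of_nonneg_left (h1.trans h2) (sq_nonneg (T : ℝ))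
      have e : (T : ℝ) ^ 2 * (T * (b k / β * b k / (δ * T) ^ 3)) = b k ^ 2 / (δ ^ 3 * β) := by
        field_simp
      rw [e] at h3
      simp only [integral_const, probReal_univ, one_smul]
      refine (mul_le_mul_of_nonneg_right (add_le_add_left h3 _) (by positivity)).trans
        (le_of_eq ?_)
      field_simp
    refine (Finset.sum_le_sum this).trans (le_of_eq ?_)
    simp only [Finset.sum_const, Finset.card_univ, nsmul_eq_mul]
    ring
  have hmR : 0 ≤ m * R := mul_nonneg (Nat.cast_nonneg _) hR0
  calc m * R * (1 - Fintype.card K * (4 / α ^ 2 * (1 / δ ^ 3 + 1)) / β)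
      ≤ m * R * (1 - ∫ ω, G ω ∂(outcomeLaw D ρ T)) :=
        mul_le_mul_of_nonneg_left (sub_le_sub_left hGE _) hmR
    _ = ∫ ω, m * R * (1 - G ω) ∂(outcomeLaw D ρ T) := by
        rw [integral_const_mul, integral_sub (integrable_const _) hGi]; simp
    _ ≤ _ := by
        refine integral_mono_ae (((integrable_const _).sub hGi).const_mul _) hVi ?_
        filter_upwards [ae_outcome hA] with ω hω
        rw [hl]
        exact (mul_le_mul_of_nonneg_left (sub_le_sub_left (hle ω) _) hmR).trans
          (hpol _ fun k => sub_nonneg.2 (osoOccupancy_mem hb0 hω t k).2)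

end OnlineAlloc
-- Summation over periods and choice of constants
namespace OnlineAlloc

variable {J K Θ : Type} {T : ℕ} [MeasurableSpace Θ] {D : Measure (Item J K)}
  [IsProbabilityMeasure D] {ρ : Measure Θ} [IsProbabilityMeasure ρ] [Fintype J] [Fintype K]
  {s : Solver J K Θ} {b : K → ℝ}

/-- The loss 4δ collects δ from dropping the last periods, 2δ from running the policy for fewer
steps than there are items, and δ from the shortfall. The reserve is `α = δ ^ 2`. -/
theorem le_expectedOSO (hs : s.IsEquivariant ρ D)
    (hr : ∀ j, Integrable (fun ξ : Item J K => ξ.1 j) D)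
    (hA : ∀ᵐ ξ ∂D, ∀ j k, 0 ≤ ξ.2 j k) (hb : ∀ k, 0 < b k) {β : ℝ} (hβ : 0 < β)
    (hM : ∀ᵐ ξ ∂D, ∀ j k, ξ.2 j k ≤ b k / β) {δ : ℝ} (hδ : 0 < δ) (hδ2 : δ ≤ 1 / 2)
    (hT : 1 ≤ δ ^ 2 * T) (hβ1 : 2 / β ≤ δ ^ 2)
    (hβ2 : Fintype.card K * (4 / (δ ^ 2) ^ 2 * (1 / δ ^ 3 + 1)) / β ≤ δ) :
    (1 - 4 * δ) * expectedOPT D T b ≤ expectedOSO s ρ D T b := by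
  have hb0 : ∀ k, 0 ≤ b k := fun k => (hb k).le
  have hT0 : (0 : ℝ) < T := by
    by_contra h
    have : (T : ℝ) = 0 := le_antisymm (not_lt.1 h) (Nat.cast_nonneg _)
    rw [this] at hT; linarith
  set g := expectedOPT D T b
  have hg : 0 ≤ g / T := div_nonneg (expectedOPT_nonneg hb0 D) hT0.le
  have hg0 : 0 ≤ g := expectedOPT_nonneg hb0 D
  set E : Fin T → ℝ := fun t => ∫ ω, reward (ω.arrival t)
    (osoDecision s b ω (osoOccupancy s b ω t) t) ∂(outcomeLaw D ρ T) with hE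
  have hlt : ∀ t : Fin T, (0 : ℝ) < T - t := fun t => sub_pos.2 (Nat.cast_lt.2 t.2)
  -- Single rewards may be negative, but the mean reward of a period is an average of optima, each
  -- nonnegative.
  have hE0 : ∀ t, 0 ≤ E t := by
    intro t
    refine nonneg_of_mul_nonneg_right (a := (T - t : ℝ)) ?_ (hlt t)
    have h := (integral_oso_reward (s := s) (ρ := ρ) hs hr hA hb0 t).2
    rw [Nat.cast_sub t.2.le] at h
    rw [hE, h]
    refine integral_nonneg_of_ae ?_
    filter_upwards [ae_outcome hA] with ω hω
    exact expectedOPT_nonneg (fun k => sub_nonneg.2 (osoOccupancy_mem hb0 hω t k).2) D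
  have hE1 : ∀ t : Fin T, (t : ℝ) ≤ (1 - δ) * T → (1 - 2 * δ) * (1 - δ) * (g / T) ≤ E t := by
    intro t ht
    have hn : δ * T ≤ T - t := by linarith
    set y : ℝ := T - t - δ ^ 2 * T with hy
    have h2 : δ ^ 2 * T ≤ δ * (T - t) := by nlinarith
    have hy0 : 0 ≤ y := by nlinarith [hlt t]
    have h := le_integral_oso_reward hs hr hA hb hβ hM hδ (pow_pos hδ 2) hβ1 t hn ⌊y⌋₊
      (by linarith [Nat.floor_le hy0])
    -- Reserve and rounding cost `δ ^ 2 * T` and at most `1 ≤ δ ^ 2 * T`, each at most `δ * (T -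
    -- t)`.
    have hm : (1 - 2 * δ) * (T - t) ≤ (⌊y⌋₊ : ℝ) := by
      have := Nat.lt_floor_add_one y
      nlinarith
    refine le_of_mul_le_mul_left (le_trans ?_ h) (hlt t)
    calc (T - t : ℝ) * ((1 - 2 * δ) * (1 - δ) * (g / T))
        = (1 - 2 * δ) * (T - t) * (g / T) * (1 - δ) := by ring
      _ ≤ ⌊y⌋₊ * (g / T) * (1 - δ) := mul_le_mul_of_nonneg_right
          (mul_le_mul_of_nonneg_right hm hg) (by linarith)
      _ ≤ _ := mul_le_mul_of_nonneg_left (by linarith) (mul_nonneg (Nat.cast_nonneg _) hg)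
  have hNT : ⌈(1 - δ) * T⌉₊ ≤ T := Nat.ceil_le.2 (by nlinarith)
  rw [expectedOSO_eq_sum hr]
  calc (1 - 4 * δ) * g ≤ (1 - δ) * ((1 - 2 * δ) * (1 - δ) * g) := by
        have : 1 - 4 * δ ≤ (1 - δ) * ((1 - 2 * δ) * (1 - δ)) := by
          nlinarith [mul_nonneg hδ.le hδ.le, mul_nonneg (mul_nonneg hδ.le hδ.le) (sub_nonneg.2 hδ2)]
        nlinarith
    _ = (1 - δ) * T * ((1 - 2 * δ) * (1 - δ) * (g / T)) := by field_simp
    _ ≤ ⌈(1 - δ) * T⌉₊ * ((1 - 2 * δ) * (1 - δ) * (g / T)) :=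
        mul_le_mul_of_nonneg_right (Nat.le_ceil _)
          (mul_nonneg (mul_nonneg (by linarith) (by linarith)) hg)
    _ = ∑ _t : Fin ⌈(1 - δ) * T⌉₊, (1 - 2 * δ) * (1 - δ) * (g / T) := by simp
    _ ≤ ∑ t : Fin ⌈(1 - δ) * T⌉₊, E (Fin.castLEEmb hNT t) :=
        Finset.sum_le_sum fun t _ => hE1 _ (Nat.lt_ceil.1 t.2).le
    _ = ∑ t ∈ Finset.univ.map (Fin.castLEEmb hNT), E t := (Finset.sum_map _ _ _).symm
    _ ≤ ∑ t, E t := Finset.sum_le_univ_sum_of_nonneg hE0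

-- In `ℝ≥0∞` one has `0 / x = 0` even for `x = 0`, so a resource of zero capacity would force the
-- minimum to be zero.
omit [IsProbabilityMeasure D] [Fintype J] [Fintype K] in
theorem pos_of_le_normalizedCapacity {β : ℝ} (hβ : 0 < β)
    (h : ENNReal.ofReal β ≤ normalizedCapacity D b) (k : K) : 0 < b k := by
  by_contra hk
  have h1 := h.trans (iInf_le _ k)
  rw [ENNReal.ofReal_of_nonpos (not_lt.1 hk), ENNReal.zero_div] at h1
  exact hβ.not_ge (ENNReal.ofReal_eq_zero.1 (le_antisymm h1 zero_le))

omit [IsProbabilityMeasure D] in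
theorem ae_le_of_le_normalizedCapacity {β : ℝ} (hβ : 0 < β)
    (h : ENNReal.ofReal β ≤ normalizedCapacity D b) : ∀ᵐ ξ ∂D, ∀ j k, ξ.2 j k ≤ b k / β := by
  rw [ae_all_iff]
  intro j
  rw [ae_all_iff]
  intro k
  filter_upwards [ENNReal.ae_le_essSup (fun ξ : Item J K => ENNReal.ofReal (ξ.2 j k))] with ξ hξ
  have h1 := ENNReal.mul_le_of_le_div (h.trans (iInf_le _ k))
  have h2 : ENNReal.ofReal β * ENNReal.ofReal (ξ.2 j k) ≤ ENNReal.ofReal (b k) :=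
    (mul_le_mul_right (hξ.trans (le_iSup (fun j => essSup
      (fun ξ : Item J K => ENNReal.ofReal (ξ.2 j k)) D) j)) _).trans h1
  rw [← ENNReal.ofReal_mul hβ.le,
    ENNReal.ofReal_le_ofReal_iff (pos_of_le_normalizedCapacity hβ h k).le] at h2
  rwa [le_div_iff₀' hβ]

end OnlineAlloc

/-! ### Asymptotic optimality -/

theorem mainTheorem2 (d : ℕ) (m : ℕ → ℕ)
    (D : ∀ T : ℕ, Measure (OnlineAlloc.Item (Fin (m T)) (Fin d)))
    [∀ T, IsProbabilityMeasure (D T)]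
    (hr : ∀ T j, Integrable (fun ξ : OnlineAlloc.Item (Fin (m T)) (Fin d) => ξ.1 j) (D T))
    (hA : ∀ T, ∀ᵐ ξ ∂(D T), ∀ j k, 0 ≤ ξ.2 j k)
    (b : ℕ → Fin d → ℝ) (hb : ∀ T k, 0 ≤ b T k)
    (Θ : Type) [MeasurableSpace Θ] (ρ : Measure Θ) [IsProbabilityMeasure ρ]
    (s : ∀ T : ℕ, OnlineAlloc.Solver (Fin (m T)) (Fin d) Θ)
    (hs : ∀ T, (s T).IsEquivariant ρ (D T))
    (σ : ℝ) (hσ : 0 < σ)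
    (hB : ∃ c : ℝ, 0 < c ∧ ∀ᶠ T : ℕ in atTop,
      ENNReal.ofReal (c * Real.log (T : ℝ) ^ (1 + σ)) ≤
        OnlineAlloc.normalizedCapacity (D T) (b T)) :
    (∀ T, OnlineAlloc.expectedOSO (s T) ρ (D T) T (b T)
        ≤ OnlineAlloc.expectedOPT (D T) T (b T)) ∧
    (∀ ε : ℝ, 0 < ε → ∀ᶠ T : ℕ in atTop,
      (1 - ε) * OnlineAlloc.expectedOPT (D T) T (b T)
        ≤ OnlineAlloc.expectedOSO (s T) ρ (D T) T (b T)) ∧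
    ((∀ᶠ T : ℕ in atTop, 0 < OnlineAlloc.expectedOPT (D T) T (b T)) →
      Tendsto (fun T : ℕ => OnlineAlloc.expectedOSO (s T) ρ (D T) T (b T) /
        OnlineAlloc.expectedOPT (D T) T (b T)) atTop (𝓝 1)) := by
  have upper : ∀ T, OnlineAlloc.expectedOSO (s T) ρ (D T) T (b T)
      ≤ OnlineAlloc.expectedOPT (D T) T (b T) := fun T =>
    OnlineAlloc.expectedOSO_le_expectedOPT (hr T) (hA T) (hb T)
  have lower : ∀ ε : ℝ, 0 < ε → ∀ᶠ T : ℕ in atTop,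
      (1 - ε) * OnlineAlloc.expectedOPT (D T) T (b T)
        ≤ OnlineAlloc.expectedOSO (s T) ρ (D T) T (b T) := by
    intro ε hε
    obtain ⟨c, hc, hB⟩ := hB
    -- This makes the total loss `4 * δ` at most `ε`.
    set δ : ℝ := min (ε / 4) (1 / 2)
    have hδ : 0 < δ := lt_min (by linarith) (by norm_num)
    -- Divergence of the capacity bound is enough: for fixed δ every requirement on `β` is a
    -- constant threshold.
    have hβ : Tendsto (fun T : ℕ => c * Real.log (T : ℝ) ^ (1 + σ)) atTop atTop :=
      ((tendsto_rpow_atTop (by linarith)).comp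
        (Real.tendsto_log_atTop.comp tendsto_natCast_atTop_atTop)).const_mul_atTop hc
    set C : ℝ := Fintype.card (Fin d) * (4 / (δ ^ 2) ^ 2 * (1 / δ ^ 3 + 1))
    filter_upwards [hB, hβ.eventually_gt_atTop 0, hβ.eventually_ge_atTop (2 / δ ^ 2),
      hβ.eventually_ge_atTop (C / δ),
      tendsto_natCast_atTop_atTop.eventually_ge_atTop (1 / δ ^ 2)] with T h1 h2 h3 h4 h5
    have h := OnlineAlloc.le_expectedOSO (hs T) (hr T) (hA T)
      (OnlineAlloc.pos_of_le_normalizedCapacity h2 h1) h2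
      (OnlineAlloc.ae_le_of_le_normalizedCapacity h2 h1) hδ (min_le_right _ _)
      ((div_le_iff₀' (pow_pos hδ 2)).1 h5)
      ((div_le_comm₀ (pow_pos hδ 2) h2).1 h3) ((div_le_comm₀ hδ h2).1 h4)
    refine le_trans (mul_le_mul_of_nonneg_right ?_
      (OnlineAlloc.expectedOPT_nonneg (hb T) (D T))) h
    linarith [min_le_left (ε / 4) (1 / 2 : ℝ)]
  refine ⟨upper, lower, fun hpos => ?_⟩
  rw [Metric.tendsto_nhds]
  intro ε hε
  filter_upwards [hpos, lower (ε / 2) (by linarith)] with T h1 h2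
  have h3 := (div_le_one h1).2 (upper T)
  have h4 := (le_div_iff₀ h1).2 h2
  rw [Real.dist_eq, abs_lt]
  constructor <;> linarith
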